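/- Let $\Gamma$ be a countably infinite (discrete) group acting continuously on a compact metrizable space $X$, and suppose that the action is distal: for a metric $\rho$ compatible with the topology of $X$ (equivalently, for every such metric), $\inf_{s\in\Gamma}\rho(sx,sy)>0$ for all distinct $x,y\in X$. For a finite family $\mathcal U$ of subsets of $X$ and a nonempty finite set $F\subseteq\Gamma$, let $\mathcal U^F=\bigvee_{s\in F}s^{-1}\mathcal U$ be the family of all sets $\bigcap_{s\in F}s^{-1}U_s$ with $U_s\in\mathcal U$ for every $s\in F$. (1) The action has zero naive topological entropy: $$h^{\rm nv}(\Gamma\curvearrowright X):=\sup_{\mathcal U}\inf_F\frac1{|F|}\log N(\mathcal U^F)=0,$$ where $\mathcal U$ ranges over the finite open covers of $X$, $F$ ranges over the nonempty finite subsets of $\Gamma$, and $N(\mathcal V)$ is the minimal cardinality of a subcover of the cover $\mathcal V$ (with the convention $\log 0=0$, relevant only when $X=\emptyset$). (2) For every $\Gamma$-invariant Borel probability measure $\mu$ on $X$, the action $\Gamma\curvearrowright(X,\mu)$ has zero naive measure entropy: $$h^{\rm nv}_\mu(\Gamma\curvearrowright X):=\sup_{\mathcal P}\inf_F\frac1{|F|}H_\mu(\mathcal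 P^F)=0,$$ where $\mathcal P$ ranges over the finite Borel partitions of $X$, $F$ ranges over the nonempty finite subsets of $\Gamma$, and $H_\mu(\mathcal Q)=-\sum_{q\in\mathcal Q}\mu(q)\log\mu(q)$ is the Shannon entropy (with $0\log 0=0$). -/

import Mathlib

namespace NaiveEntropy

section Join

variable {Γ X : Type*} [SMul Γ X]

/-- For a family `𝒰` of subsets of `X` (a cover or a partition) and a finite set `F` of group
elements, the join `𝒰^F = ⋁_{s ∈ F} s⁻¹𝒰`: its members are the sets `⋂_{s ∈ F} s⁻¹ U_s` with all
`U_s ∈ 𝒰`, where `s⁻¹ U = {x | s • x ∈ U}`. -/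
def join (F : Finset Γ) (𝒰 : Set (Set X)) : Set (Set X) :=
  {V | ∃ U : Γ → Set X, (∀ s ∈ F, U s ∈ 𝒰) ∧ V = ⋂ s ∈ F, (fun x : X => s • x) ⁻¹' (U s)}

end Join

/-- `𝒰` is a finite open cover of `X`. -/
structure IsFiniteOpenCover {X : Type*} [TopologicalSpace X] (𝒰 : Set (Set X)) : Prop where
  finite : 𝒰.Finite
  isOpen : ∀ U ∈ 𝒰, IsOpen U
  cover : ⋃₀ 𝒰 = Set.univ

/-- `𝒬` is a finite partition of `X` into (nonempty) measurable sets. -/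
structure IsFiniteMeasurablePartition {X : Type*} [MeasurableSpace X] (𝒬 : Set (Set X)) :
    Prop where
  finite : 𝒬.Finite
  measurable : ∀ P ∈ 𝒬, MeasurableSet P
  partition : Setoid.IsPartition 𝒬

/-- `N(𝒰)`: the minimal cardinality of a (finite) subcover of the cover `𝒰`. -/
noncomputable def minCard {X : Type*} (𝒰 : Set (Set X)) : ℕ :=
  sInf {n : ℕ | ∃ 𝒱 : Set (Set X), 𝒱 ⊆ 𝒰 ∧ 𝒱.Finite ∧ ⋃₀ 𝒱 = Set.univ ∧ 𝒱.ncard = n}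

/-- The naive topological entropy
`sup_𝒰 inf_F (1 / |F|) log N(𝒰^F)` of an action of `Γ` on `X`, an extended real number; here `𝒰`
ranges over the finite open covers of `X` and `F` over the nonempty finite subsets of `Γ`. -/
noncomputable def topEntropy (Γ X : Type*) [SMul Γ X] [TopologicalSpace X] : EReal :=
  ⨆ (𝒰 : Set (Set X)) (_ : IsFiniteOpenCover 𝒰), ⨅ (F : Finset Γ) (_ : F.Nonempty),
    ((1 / (F.card : ℝ) * Real.log (minCard (join F 𝒰)) : ℝ) : EReal)

/-- The Shannon entropy `-∑_{q ∈ 𝒬} μ(q) log μ(q)` of a finite family `𝒬` (a partition, possibly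
together with the empty set, which contributes `0`). -/
noncomputable def shannonEntropy {X : Type*} [MeasurableSpace X] (μ : MeasureTheory.Measure X)
    (𝒬 : Set (Set X)) : ℝ :=
  -∑ᶠ q ∈ 𝒬, μ.real q * Real.log (μ.real q)

/-- The naive measure entropy `sup_𝒬 inf_F (1 / |F|) H_μ(𝒬^F)` of an action of `Γ` on `(X, μ)`, an
extended real number; here `𝒬` ranges over the finite measurable partitions of `X` and `F` over the
nonempty finite subsets of `Γ`. -/
noncomputable def measureEntropy (Γ : Type*) {X : Type*} [SMul Γ X] [MeasurableSpace X]
    (μ : MeasureTheory.Measure X) : EReal :=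
  ⨆ (𝒬 : Set (Set X)) (_ : IsFiniteMeasurablePartition 𝒬), ⨅ (F : Finset Γ) (_ : F.Nonempty),
    ((1 / (F.card : ℝ) * shannonEntropy μ (join F 𝒬) : ℝ) : EReal)

/-- An action of `Γ` on a metrizable space `X` is distal if, for a metric `ρ` inducing the topology
of `X`, one has `inf_{s ∈ Γ} ρ (s x, s y) > 0` for all distinct `x`, `y`. On compact spaces this does
not depend on the choice of `ρ`. -/
def IsDistal (Γ X : Type*) [SMul Γ X] [t : TopologicalSpace X] : Prop :=
  ∃ ρ : MetricSpace X, ρ.toUniformSpace.toTopologicalSpace = t ∧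
    ∀ x y : X, x ≠ y → 0 < ⨅ s : Γ, ρ.dist (s • x) (s • y)

end NaiveEntropy

/-! Positive entropy would force independence along a positive proportion of every finite set,
independence forces a proximal pair off the diagonal, and distality forbids such a pair. No Følner
averaging enters: every estimate is uniform over finite subsets of `Γ`.

Independence comes from a Sauer–Shelah type dichotomy, `exists_shattered_or_isBoxCover`. A set of
words either shatters a partial map with support of proportional size, or is covered by
exponentially few boxes, at any prescribed rate, whose sides contain no separated letters. For an
open cover, such boxes lie in members of the join and give a small subcover. For a partition, the
letters are closed inner approximations of its members; a box then determines the name of a point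
except at visits to a set of small measure. So positive entropy of either kind yields a closed set
`Q` of pairs, disjoint from the diagonal, for which the pairs `(A, B)` with `A × B ⊆ Q` have
positive independence density.

For proximality, `HasPosDensity.split` shrinks one set of each pair to small diameter. In
`HasPosDensity.contract`, pigeonhole finds two independent positions `a * f` and `b * f`: the choice
varies at the first and is frozen to the small set at the second. The resulting pairs are moved into
`Q` by `a` and close to the diagonal by `b`, and still have positive density. Iteration and
compactness give the proximal pair. -/

namespace NaiveEntropy

/-! ### Shattering and box covers for sets of words -/

section Combinatorics

variable {ι V : Type*}

/-- A partial map `g` from positions to pairs of letters is shattered by a set `S` of words if its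
pairs are related by `adj` and every choice of one letter from each pair is realised in `S`. -/
def IsShattered (adj : V → V → Prop) (S : Set (ι → V)) (g : ι → Option (V × V)) : Prop :=
  (∀ i p q, g i = some (p, q) → adj p q) ∧
    ∀ ω : ι → Bool, ∃ σ ∈ S, ∀ i p q, g i = some (p, q) → σ i = if ω i then p else q

theorem IsShattered.mono {adj : V → V → Prop} {S T : Set (ι → V)} {g : ι → Option (V × V)}
    (h : IsShattered adj S g) (hST : S ⊆ T) : IsShattered adj T g :=
  ⟨h.1, fun ω => let ⟨σ, hσ, h'⟩ := h.2 ω; ⟨σ, hST hσ, h'⟩⟩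

open Classical in
/-- The partial maps supported in `L` that are shattered by `S`. -/
noncomputable def shatteredMaps [Fintype ι] [Fintype V] (adj : V → V → Prop) (L : Finset ι)
    (S : Set (ι → V)) : Finset (ι → Option (V × V)) :=
  Finset.univ.filter fun g => (∀ i, i ∉ L → g i = none) ∧ IsShattered adj S g

theorem mem_shatteredMaps [Fintype ι] [Fintype V] {adj : V → V → Prop} {L : Finset ι}
    {S : Set (ι → V)} {g : ι → Option (V × V)} :
    g ∈ shatteredMaps adj L S ↔ (∀ i, i ∉ L → g i = none) ∧ IsShattered adj S g := by
  simp [shatteredMaps]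

theorem shatteredMaps_mono [Fintype ι] [Fintype V] {adj : V → V → Prop} {L M : Finset ι}
    {S T : Set (ι → V)} (hLM : L ⊆ M) (hST : S ⊆ T) :
    shatteredMaps adj L S ⊆ shatteredMaps adj M T := by
  intro g hg
  rw [mem_shatteredMaps] at hg ⊢
  exact ⟨fun i hi => hg.1 i fun h => hi (hLM h), hg.2.mono hST⟩

/-- A map shattered by either slice is shattered by `S`. One shattered by both slices counts once
more, since it can be extended by `(p, q)` at `i`. -/
theorem card_shatteredMaps_add_le [Fintype ι] [Fintype V] [DecidableEq ι] {adj : V → V → Prop}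
    {L : Finset ι} {S : Set (ι → V)} {i : ι} (hi : i ∉ L) {p q : V} (hpq : adj p q) :
    (shatteredMaps adj L {σ ∈ S | σ i = p}).card + (shatteredMaps adj L {σ ∈ S | σ i = q}).card ≤
      (shatteredMaps adj (insert i L) S).card := by
  classical
  set A := shatteredMaps adj L {σ ∈ S | σ i = p}
  set B := shatteredMaps adj L {σ ∈ S | σ i = q}
  let e : (ι → Option (V × V)) → (ι → Option (V × V)) := fun g => Function.update g i (some (p, q))
  have hnone : ∀ g ∈ A ∪ B, g i = none := by
    intro g hg
    rcases Finset.mem_union.1 hg with h | h <;> exact (mem_shatteredMaps.1 h).1 i hi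
  have hinj : Set.InjOn e (A ∩ B : Finset _) := by
    intro g hg g' hg' h
    have hg : g ∈ A ∩ B := hg
    have hg' : g' ∈ A ∩ B := hg'
    have h1 := hnone g (Finset.mem_union_left _ (Finset.mem_inter.1 hg).1)
    have h2 := hnone g' (Finset.mem_union_left _ (Finset.mem_inter.1 hg').1)
    funext j
    by_cases hj : j = i
    · rw [hj, h1, h2]
    · simpa [e, hj] using congrFun h j
  have hdisj : Disjoint (A ∪ B) ((A ∩ B).image e) := by
    rw [Finset.disjoint_left]
    intro g hg hg'
    obtain ⟨g', -, rfl⟩ := Finset.mem_image.1 hg'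
    simpa [e] using hnone _ hg
  rw [← Finset.card_union_add_card_inter, ← Finset.card_image_of_injOn hinj,
    ← Finset.card_union_of_disjoint hdisj]
  apply Finset.card_le_card
  intro g hg
  rcases Finset.mem_union.1 hg with hg | hg
  · rcases Finset.mem_union.1 hg with hg | hg <;>
      exact shatteredMaps_mono (Finset.subset_insert _ _) (Set.sep_subset _ _) hg
  · obtain ⟨g, hg', rfl⟩ := Finset.mem_image.1 hg
    obtain ⟨hA, hB⟩ := Finset.mem_inter.1 hg'
    obtain ⟨h0, hA⟩ := mem_shatteredMaps.1 hA
    obtain ⟨-, hB⟩ := mem_shatteredMaps.1 hB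
    rw [mem_shatteredMaps]
    refine ⟨fun j hj => ?_, fun j a b hj => ?_, fun ω => ?_⟩
    · rw [Finset.mem_insert, not_or] at hj
      simpa [e, hj.1] using h0 j hj.2
    · by_cases hji : j = i
      · subst hji
        simp only [e, Function.update_self, Option.some.injEq, Prod.mk.injEq] at hj
        rwa [← hj.1, ← hj.2]
      · exact hA.1 j a b (by simpa [e, hji] using hj)
    · obtain ⟨σ, hσ, hσi, h⟩ : ∃ σ ∈ S, (σ i = if ω i then p else q) ∧
          ∀ j a b, g j = some (a, b) → σ j = if ω j then a else b := by
        cases hω : ω i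
        · obtain ⟨σ, hσ, h⟩ := hB.2 ω
          exact ⟨σ, hσ.1, by simpa using hσ.2, h⟩
        · obtain ⟨σ, hσ, h⟩ := hA.2 ω
          exact ⟨σ, hσ.1, by simpa using hσ.2, h⟩
      refine ⟨σ, hσ, fun j a b hj => ?_⟩
      by_cases hji : j = i
      · subst hji
        simp only [e, Function.update_self, Option.some.injEq, Prod.mk.injEq] at hj
        rw [hσi, hj.1, hj.2]
      · exact h j a b (by simpa [e, hji] using hj)

/-- `𝒞` is a family of boxes that covers the words in `S` on the positions `L`, with sides
containing no related pair of letters. -/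
def IsBoxCover (adj : V → V → Prop) (L : Finset ι) (S : Set (ι → V))
    (𝒞 : Finset (ι → Set V)) : Prop :=
  (∀ C ∈ 𝒞, ∀ i ∈ L, ∀ p ∈ C i, ∀ q ∈ C i, ¬ adj p q) ∧ ∀ σ ∈ S, ∃ C ∈ 𝒞, ∀ i ∈ L, σ i ∈ C i

/-- The number of shattered maps acts as a potential. At a new position, letters whose slice keeps
more than half of it are pairwise unrelated and share one side; every other letter gets its own
boxes but gains a factor `2 ^ (-β)`. -/
theorem exists_isBoxCover_card_le [Fintype ι] [Fintype V] {adj : V → V → Prop}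
    (hadj : ∀ v, ¬ adj v v) (β : ℕ) (L : Finset ι) (S : Set (ι → V)) :
    ∃ 𝒞 : Finset (ι → Set V), IsBoxCover adj L S 𝒞 ∧
      (𝒞.card : ℝ) ≤ ((shatteredMaps adj L S).card : ℝ) ^ β *
        (1 + Fintype.card V / 2 ^ β) ^ L.card := by
  classical
  induction L using Finset.induction_on generalizing S with
  | empty =>
    rcases S.eq_empty_or_nonempty with rfl | ⟨σ, hσ⟩
    · exact ⟨∅, ⟨by simp, by simp⟩, by simp⟩
    · refine ⟨{fun _ => Set.univ}, ⟨by simp, by simp⟩, ?_⟩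
      -- The empty partial map is shattered by any nonempty set.
      have : 1 ≤ (shatteredMaps adj ∅ S).card := by
        refine Finset.card_pos.2 ⟨fun _ => none, mem_shatteredMaps.2 ⟨by simp, by simp, ?_⟩⟩
        exact fun _ => ⟨σ, hσ, by simp⟩
      have : (1 : ℝ) ≤ (shatteredMaps adj ∅ S).card := by exact_mod_cast this
      simpa using one_le_pow₀ this
  | insert i L hi ih =>
    choose 𝒞 h𝒞 hcard using ih
    set M := (shatteredMaps adj (insert i L) S).card with hM
    set r : ℝ := (1 + Fintype.card V / 2 ^ β) with hr
    have hr0 : 0 ≤ r := by positivity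
    let big : Finset V :=
      Finset.univ.filter fun v => M < 2 * (shatteredMaps adj L {σ ∈ S | σ i = v}).card
    let 𝒞₀ := (𝒞 {σ ∈ S | σ i ∈ big}).image fun C => Function.update C i (big : Set V)
    let 𝒞₁ : V → Finset (ι → Set V) := fun v =>
      (𝒞 {σ ∈ S | σ i = v}).image fun C => Function.update C i {v}
    have hne : ∀ j ∈ L, j ≠ i := fun j hj h => hi (h ▸ hj)
    refine ⟨𝒞₀ ∪ bigᶜ.biUnion 𝒞₁, ⟨?_, ?_⟩, ?_⟩
    · intro C hC j hj p hp q hq hpq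
      rcases Finset.mem_union.1 hC with hC | hC
      · obtain ⟨C, hC', rfl⟩ := Finset.mem_image.1 hC
        rcases Finset.mem_insert.1 hj with rfl | hj
        · simp only [Function.update_self, Finset.mem_coe, big, Finset.mem_filter,
            Finset.mem_univ, true_and] at hp hq
          have := card_shatteredMaps_add_le (S := S) hi hpq
          omega
        · simp only [Function.update_of_ne (hne j hj)] at hp hq
          exact (h𝒞 _).1 C hC' j hj p hp q hq hpq
      · obtain ⟨v, -, hC⟩ := Finset.mem_biUnion.1 hC
        obtain ⟨C, hC', rfl⟩ := Finset.mem_image.1 hC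
        rcases Finset.mem_insert.1 hj with rfl | hj
        · simp only [Function.update_self, Set.mem_singleton_iff] at hp hq
          subst hp hq
          exact hadj _ hpq
        · simp only [Function.update_of_ne (hne j hj)] at hp hq
          exact (h𝒞 _).1 C hC' j hj p hp q hq hpq
    · intro σ hσ
      by_cases hb : σ i ∈ big
      · obtain ⟨C, hC, h⟩ := (h𝒞 {σ ∈ S | σ i ∈ big}).2 σ ⟨hσ, hb⟩
        refine ⟨_, Finset.mem_union_left _ (Finset.mem_image_of_mem _ hC), fun j hj => ?_⟩
        rcases Finset.mem_insert.1 hj with rfl | hj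
        · simpa using hb
        · simpa [hne j hj] using h j hj
      · obtain ⟨C, hC, h⟩ := (h𝒞 {τ ∈ S | τ i = σ i}).2 σ ⟨hσ, rfl⟩
        refine ⟨_, Finset.mem_union_right _ (Finset.mem_biUnion.2 ⟨σ i, by simpa using hb,
          Finset.mem_image_of_mem _ hC⟩), fun j hj => ?_⟩
        rcases Finset.mem_insert.1 hj with rfl | hj
        · simp
        · simpa [hne j hj] using h j hj
    · have h0 : (𝒞₀.card : ℝ) ≤ (M : ℝ) ^ β * r ^ L.card := by
        refine le_trans (by exact_mod_cast Finset.card_image_le) ((hcard _).trans ?_)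
        have : (shatteredMaps adj L {σ ∈ S | σ i ∈ big}).card ≤ M :=
          Finset.card_le_card (shatteredMaps_mono (Finset.subset_insert _ _) (Set.sep_subset _ _))
        gcongr
      have h1 : ∀ v ∈ bigᶜ, ((𝒞₁ v).card : ℝ) ≤ ((M : ℝ) / 2) ^ β * r ^ L.card := by
        intro v hv
        refine le_trans (by exact_mod_cast Finset.card_image_le) ((hcard _).trans ?_)
        have : 2 * (shatteredMaps adj L {σ ∈ S | σ i = v}).card ≤ M := by
          simpa [big] using hv
        have : ((shatteredMaps adj L {σ ∈ S | σ i = v}).card : ℝ) ≤ (M : ℝ) / 2 := by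
          rw [le_div_iff₀ two_pos, mul_comm]; exact_mod_cast this
        gcongr
      have h2 : ((bigᶜ.biUnion 𝒞₁).card : ℝ) ≤
          Fintype.card V * (((M : ℝ) / 2) ^ β * r ^ L.card) := by
        calc ((bigᶜ.biUnion 𝒞₁).card : ℝ) ≤ ∑ v ∈ bigᶜ, ((𝒞₁ v).card : ℝ) := by
              exact_mod_cast Finset.card_biUnion_le
          _ ≤ ∑ v ∈ bigᶜ, ((M : ℝ) / 2) ^ β * r ^ L.card := Finset.sum_le_sum h1
          _ = (bigᶜ.card : ℝ) * (((M : ℝ) / 2) ^ β * r ^ L.card) := by simp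
          _ ≤ _ := by gcongr; exact Finset.card_le_univ _
      calc (((𝒞₀ ∪ bigᶜ.biUnion 𝒞₁).card : ℕ) : ℝ)
          ≤ (𝒞₀.card : ℝ) + (bigᶜ.biUnion 𝒞₁).card := by exact_mod_cast Finset.card_union_le _ _
        _ ≤ (M : ℝ) ^ β * r ^ L.card + Fintype.card V * (((M : ℝ) / 2) ^ β * r ^ L.card) :=
          add_le_add h0 h2
        _ = (M : ℝ) ^ β * r ^ (insert i L).card := by
          rw [Finset.card_insert_of_notMem hi, pow_succ, hr, div_pow]; ring

/-- There are few partial maps with small support. -/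
theorem exists_card_support_le_exp (K : Type*) [Fintype K] {κ : ℝ} (hκ : 0 < κ) :
    ∃ θ : ℝ, 0 < θ ∧ ∀ (ι : Type*) [Fintype ι] (G : Finset (ι → Option K)),
      (∀ g ∈ G, ((Finset.univ.filter fun i => g i ≠ none).card : ℝ) ≤ θ * Fintype.card ι) →
        (G.card : ℝ) ≤ Real.exp (κ * Fintype.card ι) := by
  classical
  set k : ℝ := Fintype.card K + 1 with hk
  have hk1 : 1 ≤ k := by simp [hk]
  obtain ⟨a, ha, ha'⟩ : ∃ a : ℝ, 0 < a ∧ k * Real.exp (-a) ≤ κ / 2 := by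
    refine ⟨max 1 (-Real.log (κ / (2 * k))), by positivity, ?_⟩
    have : Real.exp (-(max 1 (-Real.log (κ / (2 * k))))) ≤ κ / (2 * k) := by
      rw [← Real.le_log_iff_exp_le (by positivity)]
      linarith [le_max_right 1 (-Real.log (κ / (2 * k)))]
    calc k * _ ≤ k * (κ / (2 * k)) := by gcongr
      _ = κ / 2 := by field_simp
  refine ⟨κ / (2 * a), by positivity, fun ι _ G hG => ?_⟩
  set n : ℝ := (Fintype.card ι : ℝ)
  -- Exponential weights: the total mass of all maps is at most `exp (κ n / 2)`, while each map of
  -- small support weighs at least `exp (-κ n / 2)`.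
  let w : Option K → ℝ := fun o => if o = none then 1 else Real.exp (-a)
  have hsum : ∑ o, w o ≤ Real.exp (κ / 2) := by
    have : ∑ o, w o = 1 + Fintype.card K * Real.exp (-a) := by
      simp [w, Fintype.sum_option]
    rw [this]
    have h1 : Fintype.card K * Real.exp (-a) ≤ κ / 2 :=
      le_trans (by gcongr; simp [hk]) ha'
    linarith [Real.add_one_le_exp (κ / 2)]
  have hw : ∀ o, 0 ≤ w o := fun o => by simp only [w]; split_ifs <;> positivity
  have htot : ∑ g : ι → Option K, ∏ i, w (g i) ≤ Real.exp (κ / 2 * n) := by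
    have h : ∑ g : ι → Option K, ∏ i, w (g i) = (∑ o, w o) ^ Fintype.card ι := by
      rw [← Finset.card_univ, ← Finset.prod_const, Finset.prod_univ_sum]
      simp
    rw [h, mul_comm, Real.exp_nat_mul]
    exact pow_le_pow_left₀ (Finset.sum_nonneg fun o _ => hw o) hsum _
  have hlow : ∀ g ∈ G, Real.exp (-(κ / 2 * n)) ≤ ∏ i, w (g i) := by
    intro g hg
    have : ∏ i, w (g i) = Real.exp (-a) ^ (Finset.univ.filter fun i => g i ≠ none).card := by
      rw [← Finset.prod_const, Finset.prod_filter]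
      refine Finset.prod_congr rfl fun i _ => ?_
      by_cases h : g i = none <;> simp [w, h]
    rw [this, ← Real.exp_nat_mul]
    apply Real.exp_le_exp.2
    have := mul_le_mul_of_nonneg_right (hG g hg) ha.le
    have e : κ / (2 * a) * n * a = κ / 2 * n := by field_simp
    linarith
  have h1 : (G.card : ℝ) * Real.exp (-(κ / 2 * n)) ≤ Real.exp (κ / 2 * n) := by
    calc (G.card : ℝ) * Real.exp (-(κ / 2 * n)) = ∑ g ∈ G, Real.exp (-(κ / 2 * n)) := by simp
      _ ≤ ∑ g ∈ G, ∏ i, w (g i) := Finset.sum_le_sum hlow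
      _ ≤ ∑ g : ι → Option K, ∏ i, w (g i) :=
        Finset.sum_le_sum_of_subset_of_nonneg (Finset.subset_univ G) fun g _ _ =>
          Finset.prod_nonneg fun i _ => hw (g i)
      _ ≤ _ := htot
  rw [Real.exp_neg, ← div_eq_mul_inv, div_le_iff₀ (Real.exp_pos _), ← Real.exp_add] at h1
  rwa [← add_mul, add_halves] at h1

/-- Either a set of words shatters a partial map with large support, or it is covered by few
boxes. -/
theorem exists_shattered_or_isBoxCover [Fintype V] {adj : V → V → Prop}
    (hadj : ∀ v, ¬ adj v v) {c : ℝ} (hc : 0 < c) :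
    ∃ θ : ℝ, 0 < θ ∧ ∀ (ι : Type*) [Fintype ι] (S : Set (ι → V)),
      (∃ g, IsShattered adj S g ∧
        θ * Fintype.card ι ≤ ((Finset.univ.filter fun i => g i ≠ none).card : ℝ)) ∨
      ∃ 𝒞 : Finset (ι → Set V), IsBoxCover adj Finset.univ S 𝒞 ∧
        (𝒞.card : ℝ) ≤ Real.exp (c * Fintype.card ι) := by
  -- Half of the rate `c` pays for the factor `1 + |V| / 2 ^ (β + 1)` per position, the other half
  -- for the power of the number of shattered maps.
  obtain ⟨β, hβ⟩ : ∃ β : ℕ, Fintype.card V / (2 : ℝ) ^ (β + 1) ≤ c / 2 := by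
    obtain ⟨β, hβ⟩ := pow_unbounded_of_one_lt (2 * Fintype.card V / c) (one_lt_two (α := ℝ))
    refine ⟨β, ?_⟩
    rw [div_lt_iff₀ hc] at hβ
    rw [div_le_iff₀ (by positivity), pow_succ]
    nlinarith [pow_pos (two_pos (α := ℝ)) β]
  obtain ⟨θ, hθ, h⟩ := exists_card_support_le_exp (V × V) (κ := c / (2 * (β + 1))) (by positivity)
  refine ⟨θ, hθ, fun ι _ S => ?_⟩
  by_cases hg : ∃ g, IsShattered adj S g ∧
      θ * Fintype.card ι ≤ ((Finset.univ.filter fun i => g i ≠ none).card : ℝ)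
  · exact Or.inl hg
  right
  push Not at hg
  obtain ⟨𝒞, h𝒞, hcard⟩ := exists_isBoxCover_card_le hadj (β + 1) Finset.univ S
  refine ⟨𝒞, h𝒞, hcard.trans ?_⟩
  have h1 := h ι (shatteredMaps adj Finset.univ S) fun g hgS =>
    (hg g (mem_shatteredMaps.1 hgS).2).le
  have h2 : (1 + Fintype.card V / (2 : ℝ) ^ (β + 1)) ≤ Real.exp (c / 2) := by
    linarith [Real.add_one_le_exp (c / 2)]
  calc ((shatteredMaps adj Finset.univ S).card : ℝ) ^ (β + 1) *
        (1 + Fintype.card V / 2 ^ (β + 1)) ^ (Finset.univ : Finset ι).card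
      ≤ Real.exp (c / (2 * (β + 1)) * Fintype.card ι) ^ (β + 1) *
        Real.exp (c / 2) ^ Fintype.card ι := by
        rw [Finset.card_univ]; gcongr
    _ = Real.exp (c * Fintype.card ι) := by
        rw [← Real.exp_nat_mul, ← Real.exp_nat_mul, ← Real.exp_add]
        congr 1
        push_cast
        field_simp
        ring

end Combinatorics

/-! ### Independence density and proximal pairs -/

section Density

variable {Γ X : Type*}

/-- A family `𝒜` of pairs of subsets of `X` has positive independence density if every finite
`F ⊆ Γ` contains a subset `J` of proportional size, to whose elements pairs from `𝒜` can be attached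
that are independent along `J`. -/
def HasPosDensity (Γ : Type*) {X : Type*} [SMul Γ X] (𝒜 : Set (Set X × Set X)) : Prop :=
  ∃ c : ℝ, 0 < c ∧ ∀ F : Finset Γ, ∃ J ⊆ F, c * F.card ≤ J.card ∧ ∃ A : Γ → Set X × Set X,
    (∀ s ∈ J, A s ∈ 𝒜) ∧
      ∀ ω : Γ → Bool, ∃ x : X, ∀ s ∈ J, s • x ∈ if ω s then (A s).1 else (A s).2

theorem HasPosDensity.mono [SMul Γ X] {𝒜 ℬ : Set (Set X × Set X)} (h : HasPosDensity Γ 𝒜)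
    (hsub : 𝒜 ⊆ ℬ) : HasPosDensity Γ ℬ := by
  obtain ⟨c, hc, h⟩ := h
  refine ⟨c, hc, fun F => ?_⟩
  obtain ⟨J, hJ, hcard, A, hA, hx⟩ := h F
  exact ⟨J, hJ, hcard, A, fun s hs => hsub (hA s hs), hx⟩

/-- It suffices to consider large finite sets. -/
theorem HasPosDensity.of_large [Group Γ] [MulAction Γ X] [Infinite Γ] {𝒜 : Set (Set X × Set X)} {c : ℝ}
    (hc : 0 < c) (n : ℕ)
    (h : ∀ F : Finset Γ, n ≤ F.card → F.Nonempty → ∃ J ⊆ F, c * F.card ≤ J.card ∧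
      ∃ A : Γ → Set X × Set X, (∀ s ∈ J, A s ∈ 𝒜) ∧
        ∀ ω : Γ → Bool, ∃ x : X, ∀ s ∈ J, s • x ∈ if ω s then (A s).1 else (A s).2) :
    HasPosDensity Γ 𝒜 := by
  classical
  obtain ⟨F₀, hF₀⟩ := Infinite.exists_subset_card_eq Γ (n + 1)
  obtain ⟨J₀, -, hJ₀, A₀, hA₀, hx₀⟩ := h F₀ (by omega) (Finset.card_pos.1 (by omega))
  have hJ₀ne : J₀.Nonempty := by
    rw [← Finset.card_pos]
    have : (0 : ℝ) < J₀.card := lt_of_lt_of_le (by rw [hF₀]; positivity) hJ₀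
    exact_mod_cast this
  obtain ⟨s₀, hs₀⟩ := hJ₀ne
  refine ⟨min c (1 / (n + 1)), by positivity, fun F => ?_⟩
  by_cases hF : n ≤ F.card ∧ F.Nonempty
  · obtain ⟨J, hJ, hcard, hind⟩ := h F hF.1 hF.2
    exact ⟨J, hJ, le_trans (by gcongr; exact min_le_left _ _) hcard, hind⟩
  rcases F.eq_empty_or_nonempty with rfl | ⟨s, hs⟩
  · exact ⟨∅, subset_rfl, by simp, A₀, by simp, fun ω => ⟨(hx₀ ω).choose, by simp⟩⟩
  have hlt : F.card ≤ n + 1 := by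
    by_contra hlt
    exact hF ⟨by omega, s, hs⟩
  -- A small nonempty set needs only one position; a pair occurring at `s₀` is transported to `s` by
  -- the action.
  refine ⟨{s}, by simpa using hs, ?_, fun _ => A₀ s₀, fun _ _ => hA₀ s₀ hs₀, fun ω => ?_⟩
  · have h1 : (F.card : ℝ) ≤ n + 1 := by exact_mod_cast hlt
    calc min c (1 / (n + 1)) * (F.card : ℝ) ≤ 1 / (n + 1) * (n + 1) := by
          gcongr; exact min_le_right _ _
      _ = ((Finset.card {s} : ℕ) : ℝ) := by
          rw [Finset.card_singleton]; field_simp; simp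
  · obtain ⟨x, hx⟩ := hx₀ fun _ => ω s
    refine ⟨s⁻¹ • s₀ • x, fun t ht => ?_⟩
    rw [Finset.mem_singleton.1 ht, smul_inv_smul]
    exact hx s₀ hs₀

theorem exists_independent_of_isShattered [SMul Γ X] {V : Type*} {adj : V → V → Prop}
    {𝒜 : Set (Set X × Set X)} {J : Finset Γ} (D : Γ → V → Set X) {S : Set (J → V)}
    (hS : ∀ σ ∈ S, ∃ x : X, ∀ s : J, (s : Γ) • x ∈ D s (σ s))
    (h𝒜 : ∀ s ∈ J, ∀ p q, adj p q → (D s p, D s q) ∈ 𝒜) {g : J → Option (V × V)}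
    (hg : IsShattered adj S g) :
    ∃ J' ⊆ J, J'.card = (Finset.univ.filter fun i => g i ≠ none).card ∧
      ∃ A : Γ → Set X × Set X, (∀ s ∈ J', A s ∈ 𝒜) ∧
        ∀ ω : Γ → Bool, ∃ x : X, ∀ s ∈ J', s • x ∈ if ω s then (A s).1 else (A s).2 := by
  classical
  have key : ∀ s : Γ, ∃ A : Set X × Set X, ∀ h : s ∈ J, ∀ p q, g ⟨s, h⟩ = some (p, q) →
      A = (D s p, D s q) := by
    intro s
    by_cases h : ∃ (h : s ∈ J) (p q : V), g ⟨s, h⟩ = some (p, q)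
    · obtain ⟨h, p, q, hpq⟩ := h
      refine ⟨(D s p, D s q), fun h' p' q' hpq' => ?_⟩
      rw [hpq, Option.some.injEq, Prod.mk.injEq] at hpq'
      rw [hpq'.1, hpq'.2]
    · exact ⟨(∅, ∅), fun h' p' q' hpq' => absurd ⟨h', p', q', hpq'⟩ h⟩
  choose A hA using key
  have hmem : ∀ s ∈ (Finset.univ.filter fun i => g i ≠ none).map (Function.Embedding.subtype _),
      ∃ (h : s ∈ J) (p q : V), g ⟨s, h⟩ = some (p, q) := by
    intro s hs
    obtain ⟨⟨t, ht⟩, hgt, rfl⟩ := Finset.mem_map.1 hs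
    obtain ⟨⟨p, q⟩, hpq⟩ := Option.ne_none_iff_exists'.1 (Finset.mem_filter.1 hgt).2
    exact ⟨ht, p, q, hpq⟩
  refine ⟨(Finset.univ.filter fun i => g i ≠ none).map (Function.Embedding.subtype _),
    fun s hs => (hmem s hs).1, Finset.card_map _, A, fun s hs => ?_, fun ω => ?_⟩
  · obtain ⟨h, p, q, hpq⟩ := hmem s hs
    rw [hA s h p q hpq]
    exact h𝒜 s h p q (hg.1 _ p q hpq)
  · obtain ⟨σ, hσ, hgσ⟩ := hg.2 fun i => ω i
    obtain ⟨x, hx⟩ := hS σ hσ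
    refine ⟨x, fun s hs => ?_⟩
    obtain ⟨h, p, q, hpq⟩ := hmem s hs
    have h1 := hx ⟨s, h⟩
    rw [hgσ _ p q hpq] at h1
    rw [hA s h p q hpq]
    cases hω : ω s <;> simpa [hω] using h1

/-- The first sets of the pairs can be taken small. -/
theorem HasPosDensity.split [SMul Γ X] [PseudoMetricSpace X] [CompactSpace X]
    {𝒜 : Set (Set X × Set X)} (h : HasPosDensity Γ 𝒜) {ε : ℝ} (hε : 0 < ε) :
    HasPosDensity Γ {B : Set X × Set X | (∀ x ∈ B.1, ∀ y ∈ B.1, dist x y ≤ ε) ∧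
      ∃ A ∈ 𝒜, B.1 ⊆ A.1 ∧ B.2 ⊆ A.2} := by
  classical
  obtain ⟨t, -, ht, hcov⟩ := finite_cover_balls_of_compact (isCompact_univ (X := X)) (half_pos hε)
  have : Finite t := ht
  have := Fintype.ofFinite t
  have hball : ∀ x : X, ∃ v : t, x ∈ Metric.ball (v : X) (ε / 2) := fun x => by
    simpa using hcov (Set.mem_univ x)
  choose lab hlab using hball
  -- The letter `none` stands for the second set, `some v` for the part of the first set in the ball
  -- around `v`.
  let adj : Option t → Option t → Prop := fun p q => p ≠ none ∧ q = none
  obtain ⟨θ, hθ, hsh⟩ := exists_shattered_or_isBoxCover (adj := adj)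
    (fun v h => h.1 h.2) (half_pos (Real.log_pos one_lt_two))
  obtain ⟨c, hc, h⟩ := h
  refine ⟨θ * c, by positivity, fun F => ?_⟩
  obtain ⟨J, hJ, hcard, A, hA, hx⟩ := h F
  choose pt hpt using hx
  have : Nonempty X := ⟨pt fun _ => true⟩
  let ext : (J → Bool) → Γ → Bool := fun ω s => if hs : s ∈ J then ω ⟨s, hs⟩ else true
  have hext : ∀ ω (s : J), ext ω s = ω s := fun ω s => by simp [ext]
  let word : (J → Bool) → J → Option t := fun ω s =>
    if ω s then some (lab ((s : Γ) • pt (ext ω))) else none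
  let D : Γ → Option t → Set X := fun s o =>
    o.elim (A s).2 fun v => (A s).1 ∩ Metric.ball (v : X) (ε / 2)
  rcases hsh J (Set.range word) with ⟨g, hg, hgc⟩ | ⟨𝒞, h𝒞, h𝒞c⟩
  · obtain ⟨J', hJ', hcard', B, hB, hx'⟩ := exists_independent_of_isShattered (X := X)
      (𝒜 := {B : Set X × Set X | (∀ x ∈ B.1, ∀ y ∈ B.1, dist x y ≤ ε) ∧
        ∃ A ∈ 𝒜, B.1 ⊆ A.1 ∧ B.2 ⊆ A.2}) D
      (by
        rintro _ ⟨ω, rfl⟩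
        refine ⟨pt (ext ω), fun s => ?_⟩
        have := hpt (ext ω) s s.2
        rw [hext] at this
        cases hω : ω s
        · simpa [word, D, hω] using this
        · simp only [hω, if_true] at this
          simpa [word, D, hω, this] using hlab _)
      (by
        rintro s hs p q ⟨hp, rfl⟩
        obtain ⟨v, rfl⟩ := Option.ne_none_iff_exists'.1 hp
        refine ⟨fun x hx y hy => ?_, A s, hA s hs, Set.inter_subset_left, subset_rfl⟩
        have h1 := Metric.mem_ball.1 hx.2
        have h2 := Metric.mem_ball.1 hy.2
        linarith [dist_triangle_right x y (v : X)])
      hg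
    refine ⟨J', hJ'.trans hJ, ?_, B, hB, hx'⟩
    rw [hcard', mul_assoc]
    refine le_trans ?_ hgc
    rw [Fintype.card_coe]
    gcongr
  · rcases J.eq_empty_or_nonempty with rfl | hJne
    · refine ⟨∅, Finset.empty_subset _, ?_, A, by simp, by simp⟩
      have : c * F.card ≤ 0 := by simpa using hcard
      rw [mul_assoc]
      simpa using mul_nonpos_of_nonneg_of_nonpos hθ.le this
    exfalso
    -- A side never mixes `none` with a ball, so a box determines `ω`. This requires `2 ^ |J|`
    -- boxes, more than the rate `log 2 / 2` allows.
    choose C hC hCw using fun ω => h𝒞.2 (word ω) ⟨ω, rfl⟩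
    have hinj : Function.Injective C := by
      intro ω ω' he
      funext s
      have h1 := hCw ω s (Finset.mem_univ _)
      have h2 := hCw ω' s (Finset.mem_univ _)
      rw [← he] at h2
      by_contra hne
      cases hω : ω s <;> cases hω' : ω' s
      · simp [hω, hω'] at hne
      · exact h𝒞.1 _ (hC ω) s (Finset.mem_univ _) _ h2 _ h1 (by simp [adj, word, hω, hω'])
      · exact h𝒞.1 _ (hC ω) s (Finset.mem_univ _) _ h1 _ h2 (by simp [adj, word, hω, hω'])
      · simp [hω, hω'] at hne
    have h1 : 2 ^ J.card ≤ 𝒞.card := by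
      have := Finset.card_le_card_of_injOn (s := Finset.univ) C (fun ω _ => hC ω) hinj.injOn
      simpa using this
    have h2 : (2 : ℝ) ^ J.card ≤ Real.exp (Real.log 2 / 2 * J.card) := by
      rw [Fintype.card_coe] at h𝒞c
      exact le_trans (by exact_mod_cast h1) h𝒞c
    have h3 : (2 : ℝ) ^ J.card = Real.exp (Real.log 2 * J.card) := by
      rw [mul_comm, Real.exp_nat_mul, Real.exp_log two_pos]
    rw [h3, Real.exp_le_exp] at h2
    have : (0 : ℝ) < J.card := by exact_mod_cast hJne.card_pos
    nlinarith [Real.log_pos one_lt_two, mul_pos (Real.log_pos one_lt_two) this]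

/-- A maximal `F'` with disjoint translates `E * f` works: by maximality each element of `F` lies in
`F'` or in some `E⁻¹ * E * f'`. -/
theorem exists_separated_subset [Group Γ] [DecidableEq Γ] (E F : Finset Γ) :
    ∃ F' ⊆ F, (∀ f ∈ F', ∀ f' ∈ F', ∀ e ∈ E, ∀ e' ∈ E, e * f = e' * f' → f = f') ∧
      F.card ≤ F'.card * (E.card * E.card + 1) := by
  classical
  let P : Finset Γ → Prop := fun F' =>
    ∀ f ∈ F', ∀ f' ∈ F', ∀ e ∈ E, ∀ e' ∈ E, e * f = e' * f' → f = f'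
  obtain ⟨F', hF', hmax⟩ := Finset.exists_max_image (F.powerset.filter P) Finset.card
    ⟨∅, by simp [P]⟩
  rw [Finset.mem_filter, Finset.mem_powerset] at hF'
  refine ⟨F', hF'.1, hF'.2, ?_⟩
  let N : Γ → Finset Γ := fun f => insert f ((E ×ˢ E).image fun e => e.1⁻¹ * (e.2 * f))
  have hsub : F ⊆ F'.biUnion N := by
    intro f hf
    by_contra hnot
    simp only [Finset.mem_biUnion, not_exists, not_and] at hnot
    have hfF : f ∉ F' := fun h => hnot f h (Finset.mem_insert_self _ _)
    have hno : ∀ f' ∈ F', ∀ e ∈ E, ∀ e' ∈ E, e * f ≠ e' * f' := by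
      intro f' hf' e he e' he' h
      refine hnot f' hf' (Finset.mem_insert_of_mem (Finset.mem_image.2
        ⟨(e, e'), Finset.mk_mem_product he he', ?_⟩))
      rw [← h, inv_mul_cancel_left]
    have := hmax (insert f F') (by
      rw [Finset.mem_filter, Finset.mem_powerset]
      refine ⟨Finset.insert_subset hf hF'.1, ?_⟩
      intro a ha b hb e he e' he' h
      rcases Finset.mem_insert.1 ha with rfl | ha' <;> rcases Finset.mem_insert.1 hb with rfl | hb'
      · rfl
      · exact absurd h (hno b hb' e he e' he')
      · exact absurd h.symm (hno a ha' e' he' e he)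
      · exact hF'.2 a ha' b hb' e he e' he' h)
    rw [Finset.card_insert_of_notMem hfF] at this
    omega
  refine (Finset.card_le_card hsub).trans (Finset.card_biUnion_le_card_mul _ _ _ fun f _ => ?_)
  refine (Finset.card_insert_le _ _).trans (Nat.succ_le_succ (Finset.card_image_le.trans ?_))
  rw [Finset.card_product]

/-- Once `E` is large compared with the inverse density, many translates `E * f` contain two
independent positions: one preserves the choice, the other brings both points into a set of diameter
at most `ε`. -/
theorem HasPosDensity.contract [Group Γ] [Infinite Γ] [MulAction Γ X] [PseudoMetricSpace X]
    [CompactSpace X] {Q : Set (X × X)} (h : HasPosDensity Γ {A : Set X × Set X | A.1 ×ˢ A.2 ⊆ Q})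
    {ε : ℝ} (hε : 0 < ε) :
    ∃ E : Finset Γ, HasPosDensity Γ {A : Set X × Set X | A.1 ×ˢ A.2 ⊆
      {z | ∃ a ∈ E, ∃ b ∈ E, a • z ∈ Q ∧ dist (b • z.1) (b • z.2) ≤ ε}} := by
  classical
  obtain ⟨c, hc, h⟩ := h.split hε
  obtain ⟨m, hm⟩ := exists_nat_gt (2 / c)
  obtain ⟨E, hE⟩ := Infinite.exists_subset_card_eq Γ m
  rw [div_lt_iff₀ hc, ← hE] at hm
  have hEpos : (0 : ℝ) < E.card := by
    by_contra h0
    nlinarith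
  refine ⟨E, 1 / (E.card * (E.card * E.card + 1)), by positivity, fun F => ?_⟩
  obtain ⟨F', hF', hsep, hFcard⟩ := exists_separated_subset E F
  let T : Γ → Finset Γ := fun f => E.image (· * f)
  have hT : ∀ f, (T f).card = E.card := fun f =>
    Finset.card_image_of_injective _ (mul_left_injective f)
  obtain ⟨J, hJ, hJcard, A, hA, hx⟩ := h (F'.biUnion T)
  have hbi : (F'.biUnion T).card = F'.card * E.card := by
    rw [Finset.card_biUnion, Finset.sum_congr rfl fun f _ => hT f, Finset.sum_const, smul_eq_mul]
    intro f hf f' hf' hne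
    refine Finset.disjoint_left.2 ?_
    intro s hs hs'
    obtain ⟨e, he, rfl⟩ := Finset.mem_image.1 hs
    obtain ⟨e', he', h'⟩ := Finset.mem_image.1 hs'
    exact hne (hsep f hf f' hf' e he e' he' h'.symm)
  let good : Finset Γ := F'.filter fun f =>
    ∃ a ∈ E, ∃ b ∈ E, a ≠ b ∧ a * f ∈ J ∧ b * f ∈ J
  have hcount : J.card ≤ F'.card + E.card * good.card := by
    have hsub : J ⊆ F'.biUnion fun f => J ∩ T f := by
      intro s hs
      obtain ⟨f, hf, hsf⟩ := Finset.mem_biUnion.1 (hJ hs)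
      exact Finset.mem_biUnion.2 ⟨f, hf, Finset.mem_inter.2 ⟨hs, hsf⟩⟩
    calc J.card ≤ ∑ f ∈ F', (J ∩ T f).card :=
          (Finset.card_le_card hsub).trans Finset.card_biUnion_le
      _ ≤ ∑ f ∈ F', (1 + if f ∈ good then E.card else 0) := by
          refine Finset.sum_le_sum fun f hf => ?_
          split_ifs with hg
          · have := Finset.card_le_card (Finset.inter_subset_right (s₁ := J) (s₂ := T f))
            rw [hT] at this
            omega
          · rw [add_zero, Finset.card_le_one]
            intro s hs t ht
            rw [Finset.mem_inter] at hs ht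
            obtain ⟨a, ha, rfl⟩ := Finset.mem_image.1 hs.2
            obtain ⟨b, hb, rfl⟩ := Finset.mem_image.1 ht.2
            by_contra hne
            exact hg (Finset.mem_filter.2 ⟨hf, a, ha, b, hb, fun h => hne (by rw [h]), hs.1, ht.1⟩)
      _ = F'.card + E.card * good.card := by
          rw [Finset.sum_add_distrib, ← Finset.sum_filter,
            Finset.filter_mem_eq_inter, Finset.inter_eq_right.2 (Finset.filter_subset _ _),
            Finset.sum_const, Finset.sum_const, smul_eq_mul, smul_eq_mul, mul_one, mul_comm]
  -- Since `c * |E| > 2`, the set `J` has at least `2 * |F'|` elements, and translates meeting it at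
  -- most once account for at most `|F'|` of them.
  have hgood : (F'.card : ℝ) ≤ E.card * good.card := by
    rw [hbi] at hJcard
    push_cast at hJcard
    have h1 : (J.card : ℝ) ≤ F'.card + E.card * good.card := by exact_mod_cast hcount
    nlinarith [mul_le_mul_of_nonneg_right hm.le (Nat.cast_nonneg (α := ℝ) F'.card)]
  have hch : ∀ f, ∃ a b : Γ, f ∈ good → a ∈ E ∧ b ∈ E ∧ a ≠ b ∧ a * f ∈ J ∧ b * f ∈ J := by
    intro f
    by_cases hf : f ∈ good
    · obtain ⟨a, ha, b, hb, h'⟩ := (Finset.mem_filter.1 hf).2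
      exact ⟨a, b, fun _ => ⟨ha, hb, h'⟩⟩
    · exact ⟨1, 1, fun h => absurd h hf⟩
  choose a b hab using hch
  refine ⟨good, (Finset.filter_subset _ _).trans hF', ?_,
    fun f => ({x | a f • x ∈ (A (a f * f)).1 ∧ b f • x ∈ (A (b f * f)).1},
      {x | a f • x ∈ (A (a f * f)).2 ∧ b f • x ∈ (A (b f * f)).1}), fun f hf => ?_, fun ω => ?_⟩
  · have h1 : (F.card : ℝ) ≤ F'.card * (E.card * E.card + 1) := by exact_mod_cast hFcard
    rw [one_div_mul_eq_div, div_le_iff₀ (by positivity)]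
    calc (F.card : ℝ) ≤ F'.card * (E.card * E.card + 1) := h1
      _ ≤ (E.card * good.card) * (E.card * E.card + 1) := by gcongr
      _ = _ := by ring
  · obtain ⟨ha, hb, -, haJ, hbJ⟩ := hab f hf
    rintro ⟨x, y⟩ ⟨hx, hy⟩
    obtain ⟨-, B, hB, hB1, hB2⟩ := hA _ haJ
    exact ⟨a f, ha, b f, hb, hB ⟨hB1 hx.1, hB2 hy.1⟩, (hA _ hbJ).1 _ hx.2 _ hy.2⟩
  -- This choice equals `ω f` at `a f * f` and `true` elsewhere, in particular at every `b f * f`;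
  -- separation makes it consistent.
  · obtain ⟨x, hx⟩ := hx fun s => decide (∀ f ∈ good, s = a f * f → ω f = true)
    refine ⟨x, fun f hf => ?_⟩
    obtain ⟨ha, hb, hne, haJ, hbJ⟩ := hab f hf
    have hsame : ∀ f' ∈ good, ∀ e ∈ E, e * f = a f' * f' → f' = f := fun f' hf' e he h' =>
      (hsep f (Finset.mem_filter.1 hf).1 f' (Finset.mem_filter.1 hf').1 e he _ (hab f' hf').1
        h').symm
    have h1 : decide (∀ f' ∈ good, a f * f = a f' * f' → ω f' = true) = ω f := by
      cases hω : ω f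
      · simp only [decide_eq_false_iff_not, not_forall]
        exact ⟨f, hf, rfl, by simp [hω]⟩
      · simp only [decide_eq_true_eq]
        intro f' hf' h'
        rwa [hsame f' hf' _ ha h']
    have h2 : decide (∀ f' ∈ good, b f * f = a f' * f' → ω f' = true) = true := by
      simp only [decide_eq_true_eq]
      intro f' hf' h'
      have := hsame f' hf' _ hb h'
      subst this
      exact absurd (mul_right_cancel h').symm hne
    have hxa := hx _ haJ
    have hxb := hx _ hbJ
    rw [h1, mul_smul] at hxa
    rw [h2, mul_smul, if_pos rfl] at hxb
    cases hω : ω f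
    · rw [hω] at hxa
      exact ⟨hxa, hxb⟩
    · rw [hω] at hxa
      exact ⟨hxa, hxb⟩

/-- Positive independence density inside a closed set of pairs produces a proximal pair in it. -/
theorem HasPosDensity.exists_proximal [Group Γ] [Infinite Γ] [MulAction Γ X]
    [PseudoMetricSpace X] [CompactSpace X] [ContinuousConstSMul Γ X] {Q : Set (X × X)}
    (hQ : IsClosed Q) (h : HasPosDensity Γ {A : Set X × Set X | A.1 ×ˢ A.2 ⊆ Q}) :
    ∃ z ∈ Q, ∀ ε > 0, ∃ s : Γ, dist (s • z.1) (s • z.2) ≤ ε := by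
  classical
  -- Density is kept only up to finitely many translates, which lets the sets `R` themselves shrink
  -- inside `Q`.
  let P : Set (X × X) → Prop := fun R => IsClosed R ∧ ∃ E : Finset Γ,
    HasPosDensity Γ {A : Set X × Set X | A.1 ×ˢ A.2 ⊆ {z | ∃ e ∈ E, e • z ∈ R}}
  have hstep : ∀ (R : {R // P R}) (n : ℕ), ∃ R' : {R // P R}, R'.1 ⊆ R.1 ∧
      ∀ z ∈ R'.1, ∃ s : Γ, dist (s • z.1) (s • z.2) ≤ 1 / (n + 1) := by
    rintro ⟨R, hR, E, hE⟩ n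
    obtain ⟨E', hE'⟩ := hE.contract (ε := 1 / (n + 1)) (by positivity)
    -- If `(e * a) • z ∈ R` and `b` brings `z` near the diagonal, then `b * (e * a)⁻¹` does so for
    -- the point of `R`.
    let G : Finset Γ := (E ×ˢ E' ×ˢ E').image fun e => e.2.2 * (e.1 * e.2.1)⁻¹
    refine ⟨⟨R ∩ ⋃ s ∈ G, {z | dist (s • z.1) (s • z.2) ≤ 1 / (n + 1)}, hR.inter ?_,
      (E ×ˢ E').image fun e => e.1 * e.2, hE'.mono ?_⟩, Set.inter_subset_left, ?_⟩
    · refine G.finite_toSet.isClosed_biUnion fun s _ => isClosed_le ?_ continuous_const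
      exact (continuous_fst.const_smul s).dist (continuous_snd.const_smul s)
    · intro A hA z hz
      obtain ⟨a, ha, b, hb, ⟨e, he, hQ'⟩, hd⟩ := hA hz
      rw [smul_smul] at hQ'
      refine ⟨e * a, Finset.mem_image_of_mem (fun e : Γ × Γ => e.1 * e.2)
        (Finset.mk_mem_product he ha), hQ', Set.mem_biUnion (x := b * (e * a)⁻¹)
        (Finset.mem_image_of_mem (fun e : Γ × Γ × Γ => e.2.2 * (e.1 * e.2.1)⁻¹)
          (Finset.mk_mem_product he (Finset.mk_mem_product ha hb))) ?_⟩
      change dist ((b * (e * a)⁻¹) • (e * a) • z.1) ((b * (e * a)⁻¹) • (e * a) • z.2) ≤ _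
      simpa only [smul_smul, inv_mul_cancel_right] using hd
    · rintro z ⟨-, hz⟩
      obtain ⟨s, -, hs⟩ := Set.mem_iUnion₂.1 hz
      exact ⟨s, hs⟩
  have hne : ∀ R, P R → R.Nonempty := by
    rintro R ⟨-, E, c, hc, hE⟩
    obtain ⟨J, hJ, hcard, A, hA, hx⟩ := hE {1}
    have h1 : (1 : Γ) ∈ J := by
      rcases Finset.subset_singleton_iff.1 hJ with rfl | rfl
      · simp at hcard
        linarith
      · simp
    obtain ⟨x, hx'⟩ := hx fun _ => true
    obtain ⟨y, hy'⟩ := hx fun _ => false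
    obtain ⟨e, -, he⟩ := hA 1 h1 (Set.mk_mem_prod (hx' 1 h1) (hy' 1 h1))
    exact ⟨_, he⟩
  choose next hnext using hstep
  let R : ℕ → {R // P R} := fun n =>
    Nat.rec ⟨Q, hQ, {1}, by simpa using h⟩ (fun n R => next R n) n
  have hR : ∀ n, R (n + 1) = next (R n) n := fun n => rfl
  obtain ⟨z, hz⟩ := IsCompact.nonempty_iInter_of_sequence_nonempty_isCompact_isClosed
    (fun n => (R n).1) (fun n => by rw [hR]; exact (hnext _ _).1) (fun n => hne _ (R n).2)
    (R 0).2.1.isCompact (fun n => (R n).2.1)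
  rw [Set.mem_iInter] at hz
  refine ⟨z, hz 0, fun ε hε => ?_⟩
  obtain ⟨n, hn⟩ := exists_nat_one_div_lt hε
  obtain ⟨s, hs⟩ := (hnext (R n) n).2 z (by rw [← hR]; exact hz (n + 1))
  exact ⟨s, hs.trans hn.le⟩

theorem not_hasPosDensity_of_isDistal [Group Γ] [Infinite Γ] [MulAction Γ X]
    [TopologicalSpace X] [CompactSpace X] [ContinuousConstSMul Γ X] (hX : IsDistal Γ X)
    {Q : Set (X × X)} (hQ : IsClosed Q) (hdiag : ∀ x, (x, x) ∉ Q) :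
    ¬ HasPosDensity Γ {A : Set X × Set X | A.1 ×ˢ A.2 ⊆ Q} := by
  intro h
  obtain ⟨ρ, rfl, hρ⟩ := hX
  obtain ⟨⟨x, y⟩, hz, hprox⟩ := h.exists_proximal hQ
  have hne : x ≠ y := fun h => hdiag x (by rwa [← h] at hz)
  obtain ⟨s, hs⟩ := hprox _ (half_pos (hρ x y hne))
  have : ⨅ s : Γ, dist (s • x) (s • y) ≤ dist (s • x) (s • y) :=
    ciInf_le ⟨0, by rintro _ ⟨s, rfl⟩; exact dist_nonneg⟩ s
  linarith [hρ x y hne]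

end Density

/-! ### Topological entropy -/

section Topological

variable {Γ X : Type*}

/-- Either every finite set contains a large independent subset, or the itineraries with respect
to a finite labelling are covered by few boxes. -/
theorem exists_independent_or_isBoxCover [SMul Γ X] {V : Type*} [Fintype V] {adj : V → V → Prop}
    (hadj : ∀ v, ¬ adj v v) {𝒜 : Set (Set X × Set X)} (D : V → Set X)
    (h𝒜 : ∀ p q, adj p q → (D p, D q) ∈ 𝒜) {lab : X → V} (hlab : ∀ x, x ∈ D (lab x))
    {c : ℝ} (hc : 0 < c) :
    ∃ θ : ℝ, 0 < θ ∧ ∀ F : Finset Γ,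
      (∃ J ⊆ F, θ * F.card ≤ J.card ∧ ∃ A : Γ → Set X × Set X, (∀ s ∈ J, A s ∈ 𝒜) ∧
        ∀ ω : Γ → Bool, ∃ x : X, ∀ s ∈ J, s • x ∈ if ω s then (A s).1 else (A s).2) ∨
      ∃ 𝒞 : Finset (F → Set V),
        IsBoxCover adj Finset.univ (Set.range fun (x : X) (s : F) => lab ((s : Γ) • x)) 𝒞 ∧
        (𝒞.card : ℝ) ≤ Real.exp (c * F.card) := by
  obtain ⟨θ, hθ, h⟩ := exists_shattered_or_isBoxCover hadj hc
  refine ⟨θ, hθ, fun F => ?_⟩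
  rcases h F (Set.range fun (x : X) (s : F) => lab ((s : Γ) • x)) with
    ⟨g, hg, hgc⟩ | ⟨𝒞, h𝒞, h𝒞c⟩
  · obtain ⟨J, hJ, hJc, hA⟩ := exists_independent_of_isShattered (X := X) (fun _ => D)
      (by rintro _ ⟨x, rfl⟩; exact ⟨x, fun s => hlab _⟩) (fun _ _ => h𝒜) hg
    refine Or.inl ⟨J, hJ, ?_, hA⟩
    rwa [hJc, ← Fintype.card_coe F]
  · exact Or.inr ⟨𝒞, h𝒞, by rwa [Fintype.card_coe] at h𝒞c⟩

theorem minCard_join_le_card [SMul Γ X] {V : Type*} {adj : V → V → Prop} {D : V → Set X}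
    {lab : X → V} (hlab : ∀ x, x ∈ D (lab x)) {𝒰 : Set (Set X)}
    (h𝒰 : ∀ C : Set V, (∀ p ∈ C, ∀ q ∈ C, ¬ adj p q) → ∃ U ∈ 𝒰, ∀ v ∈ C, D v ⊆ U)
    {F : Finset Γ} {𝒞 : Finset (F → Set V)}
    (h𝒞 : IsBoxCover adj Finset.univ (Set.range fun (x : X) (s : F) => lab ((s : Γ) • x)) 𝒞) :
    minCard (join F 𝒰) ≤ 𝒞.card := by
  classical
  have hU : ∀ (C : F → Set V) (s : Γ), ∃ U, C ∈ 𝒞 → ∀ h : s ∈ F, U ∈ 𝒰 ∧ ∀ v ∈ C ⟨s, h⟩, D v ⊆ U := by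
    intro C s
    by_cases hCs : C ∈ 𝒞 ∧ s ∈ F
    · obtain ⟨U, hU, h⟩ := h𝒰 (C ⟨s, hCs.2⟩) (h𝒞.1 C hCs.1 _ (Finset.mem_univ _))
      exact ⟨U, fun _ _ => ⟨hU, h⟩⟩
    · exact ⟨∅, fun h h' => absurd ⟨h, h'⟩ hCs⟩
  choose U hU using hU
  let W : (F → Set V) → Set X := fun C => ⋂ s ∈ F, (fun x : X => s • x) ⁻¹' U C s
  refine le_trans (b := ((𝒞.image W : Finset (Set X)) : Set (Set X)).ncard) (Nat.sInf_le
    ⟨((𝒞.image W : Finset (Set X)) : Set (Set X)), ?_, Finset.finite_toSet _, ?_, rfl⟩)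
    (by rw [Set.ncard_coe_finset]; exact Finset.card_image_le)
  · intro _ hw
    obtain ⟨C, hC, rfl⟩ := Finset.mem_image.1 hw
    exact ⟨U C, fun s hs => (hU C s hC hs).1, rfl⟩
  · refine Set.eq_univ_of_forall fun x => ?_
    obtain ⟨C, hC, hx⟩ := h𝒞.2 _ ⟨x, rfl⟩
    refine ⟨W C, Finset.mem_coe.2 (Finset.mem_image_of_mem _ hC), ?_⟩
    simp only [W, Set.mem_iInter]
    exact fun s hs => (hU C s hC hs).2 _ (hx ⟨s, hs⟩ (Finset.mem_univ _)) (hlab _)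

theorem topEntropy_nonneg [SMul Γ X] [TopologicalSpace X] : 0 ≤ topEntropy Γ X := by
  refine le_iSup₂_of_le {Set.univ} ⟨Set.finite_singleton _, by simp, by simp⟩ ?_
  refine le_iInf₂ fun F _ => ?_
  exact EReal.coe_nonneg.2 (mul_nonneg (by positivity) (Real.log_natCast_nonneg _))

theorem topEntropy_eq_zero_of_isDistal [Group Γ] [Infinite Γ] [TopologicalSpace X]
    [CompactSpace X] [TopologicalSpace.MetrizableSpace X] [MulAction Γ X] [ContinuousConstSMul Γ X]
    (hX : IsDistal Γ X) : topEntropy Γ X = 0 := by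
  classical
  refine le_antisymm (iSup₂_le fun 𝒰 h𝒰 => ?_) topEntropy_nonneg
  by_contra! hpos
  obtain ⟨c, hc, hlt⟩ := EReal.lt_iff_exists_real_btwn.1 hpos
  have hc : 0 < c := by exact_mod_cast hc
  have hF : ∀ F : Finset Γ, F.Nonempty →
      c < 1 / (F.card : ℝ) * Real.log (minCard (join F 𝒰)) := fun F hF => by
    exact_mod_cast hlt.trans_le (iInf₂_le F hF)
  rcases isEmpty_or_nonempty X with hE | hE
  · have h0 : minCard (join ({1} : Finset Γ) 𝒰) = 0 :=
      Nat.sInf_eq_zero.2 (Or.inl ⟨∅, Set.empty_subset _, Set.finite_empty,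
        Set.eq_univ_of_forall fun x => isEmptyElim x, Set.ncard_empty _⟩)
    have := hF {1} (Finset.singleton_nonempty 1)
    rw [h0] at this
    simp at this
    linarith
  let _ := TopologicalSpace.metrizableSpaceMetric X
  obtain ⟨δ, hδ, hleb⟩ := lebesgue_number_lemma_of_metric_sUnion (isCompact_univ (X := X))
    h𝒰.isOpen h𝒰.cover.ge
  obtain ⟨t, -, ht, hcov⟩ := finite_cover_balls_of_compact (isCompact_univ (X := X))
    (e := δ / 4) (by positivity)
  have : Finite t := ht
  have := Fintype.ofFinite t
  have hball : ∀ x : X, ∃ v : t, x ∈ Metric.ball (v : X) (δ / 4) := fun x => by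
    simpa using hcov (Set.mem_univ x)
  choose lab hlab using hball
  -- With balls of radius `δ / 4`, related balls are at least `δ / 4` apart, and pairwise unrelated
  -- ones all lie in one `δ`-ball, hence in a member of `𝒰`.
  let adj : t → t → Prop := fun p q => 3 * δ / 4 ≤ dist (p : X) q
  let Q : Set (X × X) := {z | δ / 4 ≤ dist z.1 z.2}
  have hQ : IsClosed Q := isClosed_le continuous_const (continuous_fst.dist continuous_snd)
  have hdiag : ∀ x, (x, x) ∉ Q := fun x hx => by
    have : δ / 4 ≤ dist x x := hx
    rw [dist_self] at this
    linarith
  have hadj : ∀ v, ¬ adj v v := fun v hv => by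
    have : 3 * δ / 4 ≤ dist (v : X) v := hv
    rw [dist_self] at this
    linarith
  obtain ⟨θ, hθ, h⟩ := exists_independent_or_isBoxCover (Γ := Γ) hadj
    (𝒜 := {A : Set X × Set X | A.1 ×ˢ A.2 ⊆ Q}) (fun v : t => Metric.ball (v : X) (δ / 4)) (by
      rintro p q hpq ⟨x, y⟩ ⟨hx, hy⟩
      have h1 : 3 * δ / 4 ≤ dist (p : X) q := hpq
      have h2 : dist x p < δ / 4 := hx
      have h3 : dist y q < δ / 4 := hy
      have h4 := dist_triangle4 (p : X) x y q
      rw [dist_comm (p : X) x] at h4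
      change δ / 4 ≤ dist x y
      linarith) hlab hc
  refine not_hasPosDensity_of_isDistal hX hQ hdiag (.of_large hθ 0 fun F _ hFne => ?_)
  refine (h F).resolve_right ?_
  rintro ⟨𝒞, h𝒞, hcard⟩
  have hle : minCard (join F 𝒰) ≤ 𝒞.card := by
    refine minCard_join_le_card (D := fun v : t => Metric.ball (v : X) (δ / 4)) hlab (fun C hC => ?_) h𝒞
    rcases C.eq_empty_or_nonempty with rfl | ⟨v, hv⟩
    · obtain ⟨x⟩ := hE
      obtain ⟨U, hU, -⟩ := hleb x (Set.mem_univ x)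
      exact ⟨U, hU, by simp⟩
    · obtain ⟨U, hU, hsub⟩ := hleb (v : X) (Set.mem_univ _)
      refine ⟨U, hU, fun w hw x hx => hsub ?_⟩
      have h1 : dist (w : X) v < 3 * δ / 4 := not_le.1 (hC w hw v hv)
      have h2 : dist x w < δ / 4 := hx
      rw [Metric.mem_ball]
      linarith [dist_triangle x (w : X) v]
  have hn : (0 : ℝ) < F.card := by exact_mod_cast hFne.card_pos
  have h1 := hF F hFne
  rw [one_div_mul_eq_div, lt_div_iff₀ hn] at h1
  rcases Nat.eq_zero_or_pos (minCard (join F 𝒰)) with h0 | h0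
  · rw [h0, Nat.cast_zero, Real.log_zero] at h1
    nlinarith
  · have h2 : (minCard (join F 𝒰) : ℝ) ≤ Real.exp (c * F.card) :=
      le_trans (by exact_mod_cast hle) hcard
    have := (Real.log_le_iff_le_exp (by exact_mod_cast h0)).2 h2
    linarith

end Topological

/-! ### Measure entropy -/

section Measure

open MeasureTheory

variable {Γ X : Type*}

/-- Apply `log t ≤ t - 1` at `t = 1 / (a i * M)`. No normalisation of the masses is needed, so the
bound applies separately to typical and exceptional names. -/
theorem sum_negMulLog_le {α : Type*} (s : Finset α) {a : α → ℝ} (ha : ∀ i ∈ s, 0 ≤ a i) {M : ℝ}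
    (hM : 0 < M) (hs : (s.card : ℝ) ≤ M) :
    ∑ i ∈ s, Real.negMulLog (a i) ≤ (∑ i ∈ s, a i) * Real.log M + 1 := by
  have h : ∀ i ∈ s, Real.negMulLog (a i) ≤ a i * Real.log M + 1 / M := by
    intro i hi
    rcases (ha i hi).eq_or_lt with h0 | h0
    · rw [← h0]
      simp [hM.le]
    · have h1 := Real.log_le_sub_one_of_pos (x := 1 / (a i * M)) (by positivity)
      rw [one_div, Real.log_inv, Real.log_mul h0.ne' hM.ne'] at h1
      have h2 := mul_le_mul_of_nonneg_left h1 h0.le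
      have h3 : a i * ((a i * M)⁻¹ - 1) = 1 / M - a i := by field_simp
      rw [h3] at h2
      rw [Real.negMulLog]
      linarith
  calc ∑ i ∈ s, Real.negMulLog (a i) ≤ ∑ i ∈ s, (a i * Real.log M + 1 / M) := Finset.sum_le_sum h
    _ = (∑ i ∈ s, a i) * Real.log M + s.card / M := by
      rw [Finset.sum_add_distrib, Finset.sum_mul, Finset.sum_const, nsmul_eq_mul, mul_one_div]
    _ ≤ _ := by gcongr; exact (div_le_one hM).2 hs

theorem shannonEntropy_nonneg [MeasurableSpace X] (μ : Measure X) [IsProbabilityMeasure μ]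
    (𝒬 : Set (Set X)) : 0 ≤ shannonEntropy μ 𝒬 := by
  rw [shannonEntropy, ← finsum_neg_distrib]
  refine finsum_nonneg fun q => ?_
  rw [← finsum_neg_distrib]
  refine finsum_nonneg fun _ => ?_
  rw [← neg_mul]
  exact Real.negMulLog_nonneg measureReal_nonneg measureReal_le_one

theorem measureEntropy_nonneg [SMul Γ X] [MeasurableSpace X] (μ : Measure X)
    [IsProbabilityMeasure μ] : 0 ≤ measureEntropy Γ μ := by
  have := μ.nonempty_of_neZero
  refine le_iSup₂_of_le {Set.univ} ⟨Set.finite_singleton _, by simp, ?_, ?_⟩ ?_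
  · simpa using (Set.empty_ne_univ (α := X))
  · exact fun x => ⟨Set.univ, by simp, by simp⟩
  refine le_iInf₂ fun F _ => ?_
  exact EReal.coe_nonneg.2 (mul_nonneg (by positivity) (shannonEntropy_nonneg μ _))

theorem shannonEntropy_join_le_sum [DecidableEq Γ] [SMul Γ X] [MeasurableSpace X] (μ : Measure X)
    [IsProbabilityMeasure μ] {𝒬 : Set (Set X)} [Fintype 𝒬] {part : X → 𝒬}
    (hpart : ∀ x (q : 𝒬), x ∈ (q : Set X) ↔ part x = q) (F : Finset Γ) :
    shannonEntropy μ (join F 𝒬) ≤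
      ∑ w : F → 𝒬, Real.negMulLog (μ.real {x | ∀ s : F, part ((s : Γ) • x) = w s}) := by
  classical
  let atom : (F → 𝒬) → Set X := fun w => {x | ∀ s : F, part ((s : Γ) • x) = w s}
  have hatom : ∀ W ∈ join F 𝒬, ∃ w, atom w = W := by
    rintro _ ⟨U, hU, rfl⟩
    refine ⟨fun s => ⟨U s, hU s s.2⟩, Set.ext fun x => ?_⟩
    simp [atom, ← hpart]
  have hfin : (join F 𝒬).Finite := (Set.finite_range atom).subset hatom
  have hterm : ∀ W, 0 ≤ Real.negMulLog (μ.real W) := fun W =>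
    Real.negMulLog_nonneg measureReal_nonneg measureReal_le_one
  have hsub : hfin.toFinset ⊆ Finset.univ.image atom := by
    intro W hW
    obtain ⟨w, rfl⟩ := hatom W (hfin.mem_toFinset.1 hW)
    exact Finset.mem_image_of_mem _ (Finset.mem_univ w)
  rw [shannonEntropy, finsum_mem_eq_finite_toFinset_sum _ hfin, ← Finset.sum_neg_distrib]
  calc ∑ W ∈ hfin.toFinset, -(μ.real W * Real.log (μ.real W))
      = ∑ W ∈ hfin.toFinset, Real.negMulLog (μ.real W) := by simp [Real.negMulLog]
    _ ≤ ∑ W ∈ Finset.univ.image atom, Real.negMulLog (μ.real W) :=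
      Finset.sum_le_sum_of_subset_of_nonneg hsub fun W _ _ => hterm W
    _ ≤ _ := Finset.sum_image_le_of_nonneg fun w _ => hterm _

/-- Markov's inequality for the frequency of visits to a set. -/
theorem measureReal_frequent_visits_le [Group Γ] [MulAction Γ X] [MeasurableSpace X]
    [MeasurableConstSMul Γ X] (μ : Measure X) [IsProbabilityMeasure μ] [SMulInvariantMeasure Γ X μ]
    {R : Set X} (hR : MeasurableSet R) [DecidablePred (· ∈ R)] {F : Finset Γ} (hF : F.Nonempty)
    {θ τ : ℝ} (hθ : 0 < θ) (hμ : μ.real R ≤ θ * τ) :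
    μ.real {x | θ * F.card ≤ ((F.filter fun s => s • x ∈ R).card : ℝ)} ≤ τ := by
  have hm : ∀ s : Γ, MeasurableSet ((fun x : X => s • x) ⁻¹' R) := fun s =>
    measurable_const_smul s hR
  let f : X → ℝ := fun x => ∑ s ∈ F, ((fun x : X => s • x) ⁻¹' R).indicator 1 x
  have hf : ∀ x, ((F.filter fun s => s • x ∈ R).card : ℝ) = f x := by
    intro x
    rw [Finset.natCast_card_filter]
    refine Finset.sum_congr rfl fun s _ => ?_
    by_cases hs : s • x ∈ R <;> simp [hs]
  have hint : ∀ s ∈ F, Integrable (((fun x : X => s • x) ⁻¹' R).indicator (1 : X → ℝ)) μ :=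
    fun s _ => (integrable_const (1 : ℝ)).indicator (hm s)
  have h1 := mul_meas_ge_le_integral_of_nonneg (μ := μ) (f := f)
    (Filter.Eventually.of_forall fun x => by rw [← hf]; exact Nat.cast_nonneg _)
    (integrable_finsetSum _ hint) (θ * F.card)
  have h2 : ∫ x, f x ∂μ = F.card * μ.real R := by
    rw [integral_finsetSum _ hint, Finset.sum_congr rfl fun s _ => integral_indicator_one (hm s)]
    simp [Measure.real, SMulInvariantMeasure.measure_preimage_smul _ hR]
  have hn : (0 : ℝ) < F.card := by exact_mod_cast hF.card_pos
  simp only [hf]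
  rw [h2] at h1
  have h3 : θ * F.card * μ.real {x | θ * F.card ≤ f x} ≤ θ * F.card * τ := by
    calc _ ≤ F.card * μ.real R := h1
      _ ≤ F.card * (θ * τ) := by gcongr
      _ = _ := by ring
  exact le_of_mul_le_mul_left h3 (by positivity)

/-- Points with few visits to the unlabelled set have at most `exp ((c + κ) * |F|)` names; the
others have mass at most `τ` and at most `|P| ^ |F|` names. -/
theorem sum_negMulLog_itinerary_le [DecidableEq Γ] [Group Γ] [MulAction Γ X] [MeasurableSpace X]
    [MeasurableConstSMul Γ X] (μ : Measure X) [IsProbabilityMeasure μ] [SMulInvariantMeasure Γ X μ]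
    {P : Type*} [Fintype P] {part : X → P} (hpart : ∀ q, MeasurableSet (part ⁻¹' {q}))
    {lab : X → Option P} (hlab : ∀ x q, lab x = some q → part x = q)
    (hrest : MeasurableSet {x | lab x = none}) {F : Finset Γ} (hF : F.Nonempty)
    {θ τ κ c : ℝ} (hθ : 0 < θ) (hκ : 0 ≤ κ) (hc : 0 ≤ c)
    (hμ : μ.real {x | lab x = none} ≤ θ * τ)
    (hball : ∀ G : Finset (F → Option P),
      (∀ g ∈ G, ((Finset.univ.filter fun i => g i ≠ none).card : ℝ) ≤ θ * Fintype.card F) →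
        (G.card : ℝ) ≤ Real.exp (κ * Fintype.card F))
    {𝒞 : Finset (F → Set (Option P))}
    (h𝒞 : IsBoxCover (fun p q => p ≠ none ∧ q ≠ none ∧ p ≠ q) Finset.univ
      (Set.range fun (x : X) (s : F) => lab ((s : Γ) • x)) 𝒞)
    (hcard : (𝒞.card : ℝ) ≤ Real.exp (c * F.card)) :
    ∑ w : F → P, Real.negMulLog (μ.real {x | ∀ s : F, part ((s : Γ) • x) = w s}) ≤
      2 + (c + κ + τ * Real.log (Fintype.card P)) * F.card := by
  classical
  obtain ⟨x₀⟩ := μ.nonempty_of_neZero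
  let name : X → F → P := fun x s => part ((s : Γ) • x)
  have hatom : ∀ w : F → P, {x | ∀ s : F, part ((s : Γ) • x) = w s} = name ⁻¹' {w} := fun w =>
    Set.ext fun x => by simp [name, funext_iff]
  have hmeas : ∀ w : F → P, MeasurableSet (name ⁻¹' {w}) := by
    intro w
    rw [← hatom, Set.ofPred_forall]
    exact MeasurableSet.iInter fun s => measurable_const_smul (s : Γ) (hpart (w s))
  have hsum : ∀ G : Finset (F → P),
      ∑ w ∈ G, μ.real (name ⁻¹' {w}) = μ.real (name ⁻¹' (G : Set (F → P))) := fun G =>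
    sum_measureReal_preimage_singleton G (fun w _ => hmeas w)
  let Y : Set X := {x | ((F.filter fun s => s • x ∈ {x | lab x = none}).card : ℝ) < θ * F.card}
  have hY : μ.real Yᶜ ≤ τ := by
    have := measureReal_frequent_visits_le μ hrest hF hθ hμ
    convert this using 3
    ext x
    simp [Y]
  let G : Finset (F → P) := Finset.univ.filter fun w => (name ⁻¹' {w} ∩ Y).Nonempty
  have hG : (G.card : ℝ) ≤ Real.exp ((c + κ) * F.card) := by
    have hu : ∀ C : F → Set (Option P), ∃ u : F → P, C ∈ 𝒞 → ∀ s q, some q ∈ C s → q = u s := by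
      intro C
      have : ∀ s, ∃ p : P, C ∈ 𝒞 → ∀ q, some q ∈ C s → q = p := by
        intro s
        by_cases h : ∃ p, some p ∈ C s
        · obtain ⟨p, hp⟩ := h
          refine ⟨p, fun hC q hq => ?_⟩
          by_contra hne
          exact h𝒞.1 C hC s (Finset.mem_univ _) _ hq _ hp (by simpa using hne)
        · exact ⟨part x₀, fun _ q hq => absurd ⟨q, hq⟩ h⟩
      choose u hu using this
      exact ⟨u, fun hC s q hq => hu s hC q hq⟩
    choose u hu using hu
    let B : Finset (F → Option P) := Finset.univ.filter fun g =>
      ((Finset.univ.filter fun i => g i ≠ none).card : ℝ) ≤ θ * Fintype.card F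
    have hB : (B.card : ℝ) ≤ Real.exp (κ * F.card) := by
      have := hball B fun g hg => (Finset.mem_filter.1 hg).2
      rwa [Fintype.card_coe] at this
    -- A name is read off the box, with corrections recorded by a partial map supported on the
    -- unlabelled visits.
    have hsub : G ⊆ (𝒞 ×ˢ B).image fun z s => (z.2 s).getD (u z.1 s) := by
      intro w hw
      obtain ⟨x, rfl, hxY⟩ := (Finset.mem_filter.1 hw).2
      obtain ⟨C, hC, hx⟩ := h𝒞.2 _ ⟨x, rfl⟩
      refine Finset.mem_image.2 ⟨(C, fun s => if lab ((s : Γ) • x) = none then some (name x s)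
        else none), Finset.mk_mem_product hC (Finset.mem_filter.2 ⟨Finset.mem_univ _, ?_⟩), ?_⟩
      · refine le_trans ?_ (le_of_lt (by rw [Fintype.card_coe]; exact hxY))
        refine Nat.cast_le.2 (Finset.card_le_card_of_injOn (fun s : F => (s : Γ)) ?_
          Subtype.val_injective.injOn)
        intro s hs
        simp only [Finset.coe_filter, Finset.mem_univ, true_and, Set.mem_ofPred_eq] at hs ⊢
        refine ⟨s.2, ?_⟩
        by_contra h
        simp [h] at hs
      · funext s
        rcases h : lab ((s : Γ) • x) with _ | q
        · simp [h]
        · have h1 := hx s (Finset.mem_univ _)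
          simp only [h] at h1
          simp only [h, reduceCtorEq, if_false, Option.getD_none]
          rw [← hu C hC s q h1]
          exact (hlab _ _ h).symm
    calc (G.card : ℝ) ≤ (𝒞.card : ℝ) * B.card := by
          exact_mod_cast (Finset.card_le_card hsub).trans
            (Finset.card_image_le.trans (Finset.card_product _ _).le)
      _ ≤ Real.exp (c * F.card) * Real.exp (κ * F.card) := by gcongr
      _ = _ := by rw [← Real.exp_add, add_mul]
  have hn : (0 : ℝ) ≤ F.card := Nat.cast_nonneg _
  have hP : 0 < Fintype.card P := Fintype.card_pos_iff.2 ⟨part x₀⟩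
  have h1 := sum_negMulLog_le G (a := fun w => μ.real (name ⁻¹' {w}))
    (fun _ _ => measureReal_nonneg) (Real.exp_pos _) hG
  have h2 := sum_negMulLog_le Gᶜ (a := fun w => μ.real (name ⁻¹' {w}))
    (fun _ _ => measureReal_nonneg) (M := (Fintype.card P : ℝ) ^ F.card) (by positivity) (by
      have := Finset.card_le_univ Gᶜ
      rw [Fintype.card_fun, Fintype.card_coe] at this
      exact_mod_cast this)
  rw [hsum, Real.log_exp] at h1
  rw [hsum, Real.log_pow] at h2
  have h3 : μ.real (name ⁻¹' (G : Set (F → P))) ≤ 1 := measureReal_le_one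
  have h4 : μ.real (name ⁻¹' ((Gᶜ : Finset (F → P)) : Set (F → P))) ≤ τ := by
    refine (measureReal_mono fun x hx hxY => ?_).trans hY
    have hx : name x ∈ Gᶜ := hx
    exact Finset.mem_compl.1 hx (Finset.mem_filter.2 ⟨Finset.mem_univ _, x, rfl, hxY⟩)
  have hlog : 0 ≤ Real.log (Fintype.card P) := Real.log_natCast_nonneg _
  have h5 := mul_le_mul_of_nonneg_right h3 (show 0 ≤ (c + κ) * F.card by positivity)
  have h6 := mul_le_mul_of_nonneg_right h4 (mul_nonneg hn hlog)
  simp only [hatom]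
  rw [← Finset.sum_add_sum_compl G]
  linarith

theorem measureEntropy_eq_zero_of_isDistal [Group Γ] [Infinite Γ] [TopologicalSpace X]
    [CompactSpace X] [TopologicalSpace.MetrizableSpace X] [MulAction Γ X] [ContinuousConstSMul Γ X]
    [MeasurableSpace X] [BorelSpace X] (hX : IsDistal Γ X) (μ : Measure X)
    [IsProbabilityMeasure μ] [SMulInvariantMeasure Γ X μ] : measureEntropy Γ μ = 0 := by
  classical
  refine le_antisymm (iSup₂_le fun 𝒬 h𝒬 => ?_) (measureEntropy_nonneg μ)
  by_contra! hpos
  obtain ⟨c, hc, hlt⟩ := EReal.lt_iff_exists_real_btwn.1 hpos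
  have hc : 0 < c := by exact_mod_cast hc
  have hF : ∀ F : Finset Γ, F.Nonempty →
      c < 1 / (F.card : ℝ) * shannonEntropy μ (join F 𝒬) := fun F hF => by
    exact_mod_cast hlt.trans_le (iInf₂_le F hF)
  have : Finite 𝒬 := h𝒬.finite
  have := Fintype.ofFinite 𝒬
  obtain ⟨x₀⟩ := μ.nonempty_of_neZero
  have hpart : ∀ x, ∃ p : 𝒬, ∀ q : 𝒬, x ∈ (q : Set X) ↔ p = q := by
    intro x
    obtain ⟨p, ⟨hp, hxp⟩, huniq⟩ := h𝒬.partition.2 x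
    refine ⟨⟨p, hp⟩, fun q => ⟨fun hq => ?_, ?_⟩⟩
    · exact Subtype.ext (huniq q ⟨q.2, hq⟩).symm
    · rintro rfl
      exact hxp
  choose part hpart using hpart
  have hpart' : ∀ q : 𝒬, part ⁻¹' {q} = q := fun q => Set.ext fun x => (hpart x q).symm
  have hm : 0 < Fintype.card 𝒬 := Fintype.card_pos_iff.2 ⟨part x₀⟩
  have hlog : 0 ≤ Real.log (Fintype.card 𝒬) := Real.log_natCast_nonneg _
  obtain ⟨θ, hθ, hball⟩ := exists_card_support_le_exp 𝒬 (κ := c / 8) (by positivity)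
  set τ : ℝ := c / (8 * (1 + Real.log (Fintype.card 𝒬))) with hτ
  have hτ0 : 0 < τ := by positivity
  have hτlog : τ * Real.log (Fintype.card 𝒬) ≤ c / 8 := by
    rw [hτ, div_mul_eq_mul_div, div_le_div_iff₀ (by positivity) (by positivity)]
    nlinarith
  have hK : ∀ q : 𝒬, ∃ K ⊆ (q : Set X), IsClosed K ∧
      μ.real ((q : Set X) \ K) ≤ θ * τ / Fintype.card 𝒬 := by
    intro q
    have hpos : 0 < θ * τ / Fintype.card 𝒬 := by positivity
    obtain ⟨K, hK, hKc, hlt⟩ := (h𝒬.measurable q q.2).exists_isClosed_sdiff_lt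
      (measure_ne_top μ _) (ENNReal.ofReal_pos.2 hpos).ne'
    exact ⟨K, hK, hKc, ENNReal.toReal_le_of_le_ofReal hpos.le hlt.le⟩
  choose K hKq hKc hKμ using hK
  let lab : X → Option 𝒬 := fun x => if x ∈ K (part x) then some (part x) else none
  have hlab : ∀ x q, lab x = some q → part x = q ∧ x ∈ K q := by
    intro x q h
    by_cases hx : x ∈ K (part x)
    · simp only [lab, hx, if_true, Option.some.injEq] at h
      exact ⟨h, h ▸ hx⟩
    · simp [lab, hx] at h
  have hrest : {x | lab x = none} = ⋃ q : 𝒬, ((q : Set X) \ K q) := by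
    ext x
    have h1 : lab x = none ↔ x ∉ K (part x) := by simp [lab]
    simp only [Set.mem_ofPred_eq, h1, Set.mem_iUnion, Set.mem_sdiff, hpart]
    exact ⟨fun h => ⟨_, rfl, h⟩, fun ⟨q, hq, h⟩ => hq ▸ h⟩
  have hrestm : MeasurableSet {x | lab x = none} := by
    rw [hrest]
    exact MeasurableSet.iUnion fun q => (h𝒬.measurable q q.2).diff (hKc q).measurableSet
  have hrestμ : μ.real {x | lab x = none} ≤ θ * τ := by
    rw [hrest]
    refine (measureReal_iUnion_fintype_le _).trans ((Finset.sum_le_sum fun q _ => hKμ q).trans ?_)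
    rw [Finset.sum_const, Finset.card_univ, nsmul_eq_mul]
    field_simp
    exact le_rfl
  let Q : Set (X × X) := ⋃ p : 𝒬, ⋃ q : 𝒬, ⋃ _ : p ≠ q, K p ×ˢ K q
  have hQ : IsClosed Q := isClosed_iUnion_of_finite fun p => isClosed_iUnion_of_finite fun q =>
    isClosed_iUnion_of_finite fun _ => (hKc p).prod (hKc q)
  have hdiag : ∀ x, (x, x) ∉ Q := by
    intro x hx
    simp only [Q, Set.mem_iUnion] at hx
    obtain ⟨p, q, hne, hp, hq⟩ := hx
    exact hne (((hpart x p).1 (hKq p hp)).symm.trans ((hpart x q).1 (hKq q hq)))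
  let D : Option 𝒬 → Set X := fun o => o.elim Set.univ K
  obtain ⟨θ', hθ', h⟩ := exists_independent_or_isBoxCover (Γ := Γ)
    (adj := fun p q : Option 𝒬 => p ≠ none ∧ q ≠ none ∧ p ≠ q) (fun v h => h.2.2 rfl)
    (𝒜 := {A : Set X × Set X | A.1 ×ˢ A.2 ⊆ Q}) D (by
      rintro p q ⟨hp, hq, hpq⟩
      obtain ⟨p, rfl⟩ := Option.ne_none_iff_exists'.1 hp
      obtain ⟨q, rfl⟩ := Option.ne_none_iff_exists'.1 hq
      rintro z hz
      simp only [Q, Set.mem_iUnion]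
      exact ⟨p, q, fun h => hpq (by rw [h]), hz⟩)
    (lab := lab) (fun x => by
      rcases hx : lab x with _ | q
      · exact Set.mem_univ x
      · exact (hlab x q hx).2) (c := c / 8) (by positivity)
  -- For `|F| ≥ 4 / c` the additive `2` is at most `c * |F| / 2`; with the three errors `c / 8` the
  -- bound stays below `c * |F|`.
  obtain ⟨n, hn⟩ := exists_nat_ge (4 / c)
  refine not_hasPosDensity_of_isDistal hX hQ hdiag (.of_large hθ' n fun F hFn hFne => ?_)
  refine (h F).resolve_right ?_
  rintro ⟨𝒞, h𝒞, hcard⟩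
  have h1 := (shannonEntropy_join_le_sum μ hpart F).trans
    (sum_negMulLog_itinerary_le μ (fun q => by rw [hpart']; exact h𝒬.measurable q q.2)
      (fun x q hx => (hlab x q hx).1) hrestm hFne hθ (by positivity) (by positivity) hrestμ
      (fun G => hball F G) h𝒞 hcard)
  have h2 := hF F hFne
  have h3 : (0 : ℝ) < F.card := by exact_mod_cast hFne.card_pos
  rw [one_div_mul_eq_div, lt_div_iff₀ h3] at h2
  have h4 : 4 / c ≤ F.card := hn.trans (by exact_mod_cast hFn)
  rw [div_le_iff₀ hc] at h4
  have h5 := mul_le_mul_of_nonneg_right hτlog h3.le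
  nlinarith

end Measure

end NaiveEntropy

theorem corollary1p2 {Γ X : Type*} [Group Γ] [Countable Γ] [Infinite Γ]
    [TopologicalSpace X] [CompactSpace X] [TopologicalSpace.MetrizableSpace X]
    [MulAction Γ X] [ContinuousConstSMul Γ X]
    [MeasurableSpace X] [BorelSpace X]
    (hdistal : NaiveEntropy.IsDistal Γ X) :
    NaiveEntropy.topEntropy Γ X = 0 ∧
      ∀ μ : MeasureTheory.Measure X, MeasureTheory.IsProbabilityMeasure μ →
        MeasureTheory.SMulInvariantMeasure Γ X μ → NaiveEntropy.measureEntropy Γ μ = 0 :=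
  ⟨NaiveEntropy.topEntropy_eq_zero_of_isDistal hdistal, fun μ _ _ =>
    NaiveEntropy.measureEntropy_eq_zero_of_isDistal hdistal μ⟩
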